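/- All topological spaces are non-empty. Let $\mathcal L^2$ be the two-sorted first-order language with point variables $x,y,\dots$ (ranging over the points of a space), open variables $U,V,\dots$ (ranging over its open sets), atomic formulas $\top$, $x=y$, $U=V$, $x\,\varepsilon\,U$, connectives $\neg,\wedge$, and quantifiers $\exists x$, $\exists U$; here $\forall U.\alpha$ stands for $\neg\exists U.\neg\alpha$ and $\phi\to\psi$ for $\neg(\phi\wedge\neg\psi)$. A formula is positive (negative) in $U$ if all free occurrences of $U$ in it are under an even (odd) number of negation signs; an occurrence of $U$ in an equation $U=V$ or $V=U$ counts as both positive and negative, because such an equation stands for $\forall x.(x\,\varepsilon\,U\leftrightarrow x\,\varepsilon\,V)$. The fragment $\mathcal L_t$ contains the atomic formulas and is closed under $\neg$, $\wedge$, quantification over points, and the formation of $\forall U.(x\,\varepsilon\,U\to\alpha)$ for $\alpha$ positive in $U$ and of $\exists U.(x\,\varepsilon\,U\wedge\alpha)$ for $\alpha$ negative in $U$. A class of spaces is $\mathcal L_t$-definable if it is the class of all spaces in which every member of some set of $\mathcal L_t$-sentences is true. Fix disjoint countably infinite sets of propositional letters $p$ and nominals $i$. The formulas of $\mathcal H(E)$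 are $$\phi ::= \top \mid p \mid i \mid \phi\wedge\phi \mid \neg\phi \mid \Box\phi \mid @_i\phi \mid E\phi .$$ A valuation on a space $X$ sends propositional letters to subsets of $X$ and nominals to singleton subsets of $X$. Truth at a point is defined as usual for $\top$, $\wedge$, $\neg$; a letter or nominal is true at $w$ iff $w$ belongs to its value; $\Box\phi$ is true at $w$ iff $\phi$ is true throughout some open neighbourhood of $w$; $@_i\phi$ is true at $w$ iff $\phi$ is true at the point named by $i$; $E\phi$ is true at $w$ iff $\phi$ is true at some point of $X$. A formula is valid in $X$ if it is true at all points of $X$ under all valuations. A class of spaces is definable in $\mathcal H(E)$ if it is the class of all spaces in which every member of some set of $\mathcal H(E)$-formulas is valid. For a space $Y$, a filter on $Y$ is open if it contains the interior of each of its members. The Alexandroff extension $Y^*$ is the set of ultrafilters on $Y$ with the topology generated by the sets $\{\mathfrak u\mid \mathcal F\subseteq\mathfrak u\}$, for $\mathcal F$ an open filter on $Y$. The space $Y$ is a topological ultrafilter morphic image of $X$ if there is a surjective continuous open map $f:X\to Y^*$ such that for every $y\in Y$ the principal ultrafilter $\pi_y$ has exactly one preimage under $f$. Theorem. Let $\mathsf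 K$ be an $\mathcal L_t$-definable class of topological spaces. Then $\mathsf K$ is definable in $\mathcal H(E)$ if and only if $\mathsf K$ is closed under topological ultrafilter morphic images. -/

import Mathlib

universe u v

/-! ## The two-sorted language of points and open sets -/

/-- Formulas of the two-sorted first-order language `L²` with a unary predicate symbol for each
element of `P`.  Point variables and open variables are both indexed by `ℕ`. -/
inductive L2Formula (P : Type v) : Type v
  | top : L2Formula P
  /-- `x = y` for point variables `x`, `y` -/
  | eqPoint (x y : ℕ) : L2Formula P
  /-- `U = V` for open variables `U`, `V` -/
  | eqOpen (U V : ℕ) : L2Formula P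
  /-- `P_p(x)` -/
  | pred (p : P) (x : ℕ) : L2Formula P
  /-- `x ε U` -/
  | mem (x U : ℕ) : L2Formula P
  | neg (φ : L2Formula P) : L2Formula P
  | and (φ ψ : L2Formula P) : L2Formula P
  /-- `∃ x. φ` for a point variable `x` -/
  | exPoint (x : ℕ) (φ : L2Formula P) : L2Formula P
  /-- `∃ U. φ` for an open variable `U` -/
  | exOpen (U : ℕ) (φ : L2Formula P) : L2Formula P

namespace L2Formula

variable {P : Type v}

/-- `φ → ψ`, an abbreviation for `¬ (φ ∧ ¬ ψ)`. -/
def imp (φ ψ : L2Formula P) : L2Formula P := neg (and φ (neg ψ))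

/-- `∀ U. φ`, an abbreviation for `¬ ∃ U. ¬ φ`. -/
def allOpen (U : ℕ) (φ : L2Formula P) : L2Formula P := neg (exOpen U (neg φ))

/-- The free point variables of a formula. -/
def freePoints : L2Formula P → Set ℕ
  | top => ∅
  | eqPoint x y => {x, y}
  | eqOpen _ _ => ∅
  | pred _ x => {x}
  | mem x _ => {x}
  | neg φ => φ.freePoints
  | and φ ψ => φ.freePoints ∪ ψ.freePoints
  | exPoint x φ => φ.freePoints \ {x}
  | exOpen _ φ => φ.freePoints

/-- The free open variables of a formula. -/
def freeOpens : L2Formula P → Set ℕ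
  | top => ∅
  | eqPoint _ _ => ∅
  | eqOpen U V => {U, V}
  | pred _ _ => ∅
  | mem _ U => {U}
  | neg φ => φ.freeOpens
  | and φ ψ => φ.freeOpens ∪ ψ.freeOpens
  | exPoint _ φ => φ.freeOpens
  | exOpen U φ => φ.freeOpens \ {U}

/-- A sentence is a formula without free variables of either sort. -/
def IsSentence (φ : L2Formula P) : Prop := φ.freePoints = ∅ ∧ φ.freeOpens = ∅

/-- `φ.HasSign U true` says that `φ` is positive in the open variable `U`: all free occurrences of
`U` are under an even number of negation signs; `φ.HasSign U false` says that `φ` is negative in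
`U`: they are all under an odd number of negation signs.  Each free occurrence in an equation
between open variables counts both as a positive and as a negative one, since `U = V` stands for
`∀ x. (x ε U ↔ x ε V)`; so a formula in which `U` occurs free in such an equation is neither
positive nor negative in `U`. -/
def HasSign (U : ℕ) : Bool → L2Formula P → Prop
  | _, top => True
  | _, eqPoint _ _ => True
  | _, eqOpen V W => V ≠ U ∧ W ≠ U
  | _, pred _ _ => True
  | b, mem _ V => V = U → b = true
  | b, neg φ => HasSign U (!b) φ
  | b, and φ ψ => HasSign U b φ ∧ HasSign U b ψ
  | b, exPoint _ φ => HasSign U b φ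
  | b, exOpen V φ => V = U ∨ HasSign U b φ

/-- `φ` is positive in the open variable `U`. -/
def PositiveIn (φ : L2Formula P) (U : ℕ) : Prop := HasSign U true φ

/-- `φ` is negative in the open variable `U`. -/
def NegativeIn (φ : L2Formula P) (U : ℕ) : Prop := HasSign U false φ

/-- The fragment `L_t` of `L²`: it contains the atomic formulas, it is closed under the Boolean
connectives and quantification over points, and it allows quantification over opens only in the
forms `∀ U. (x ε U → α)` with `α` positive in `U`, and `∃ U. (x ε U ∧ α)` with `α` negative
in `U`. -/
inductive IsLt : L2Formula P → Prop
  | top : IsLt top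
  | eqPoint (x y : ℕ) : IsLt (eqPoint x y)
  | eqOpen (U V : ℕ) : IsLt (eqOpen U V)
  | pred (p : P) (x : ℕ) : IsLt (pred p x)
  | mem (x U : ℕ) : IsLt (mem x U)
  | neg {φ : L2Formula P} : IsLt φ → IsLt (neg φ)
  | and {φ ψ : L2Formula P} : IsLt φ → IsLt ψ → IsLt (and φ ψ)
  | exPoint (x : ℕ) {φ : L2Formula P} : IsLt φ → IsLt (exPoint x φ)
  | allOpen (x U : ℕ) {α : L2Formula P} :
      IsLt α → α.PositiveIn U → IsLt (allOpen U (imp (mem x U) α))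
  | exOpen (x U : ℕ) {α : L2Formula P} :
      IsLt α → α.NegativeIn U → IsLt (exOpen U (and (mem x U) α))

/-- Satisfaction of an `L²`-formula in a set `X` where the open variables range over the
collection `σ` of subsets of `X`, the predicate symbols are interpreted by the valuation `ν`, and
`g`, `G` are the assignments to the point variables and the open variables. -/
def Realize {X : Type u} (σ : Set (Set X)) (ν : P → Set X) :
    L2Formula P → (ℕ → X) → (ℕ → Set X) → Prop
  | top, _, _ => True
  | eqPoint x y, g, _ => g x = g y
  | eqOpen U V, _, G => G U = G V
  | pred p x, g, _ => g x ∈ ν p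
  | mem x U, g, G => g x ∈ G U
  | neg φ, g, G => ¬ Realize σ ν φ g G
  | and φ ψ, g, G => Realize σ ν φ g G ∧ Realize σ ν ψ g G
  | exPoint x φ, g, G => ∃ d : X, Realize σ ν φ (Function.update g x d) G
  | exOpen U φ, g, G => ∃ O ∈ σ, Realize σ ν φ g (Function.update G U O)

end L2Formula

/-- Truth of a formula without predicate symbols in a topological space, where the open variables
range over all open sets: it holds under all assignments of points and open sets to the
variables.  (For sentences the assignment is irrelevant.) -/
def SpaceModels (X : Type u) [TopologicalSpace X] (φ : L2Formula Empty) : Prop :=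
  ∀ (g : ℕ → X) (G : ℕ → Set X), (∀ n, IsOpen (G n)) →
    φ.Realize {O : Set X | IsOpen O} (fun p => p.elim) g G

/-! ## Classes of spaces -/

/-- A class of (non-empty) topological spaces. -/
abbrev SpaceClass : Type (u + 1) :=
  ∀ (X : Type u) [Nonempty X] [TopologicalSpace X], Prop

/-- A class of spaces is `L_t`-definable if it is the class of all spaces in which every member of
some set of `L_t`-sentences (without predicate symbols) is true. -/
def LtDefinable (K : SpaceClass.{u}) : Prop :=
  ∃ Γ : Set (L2Formula Empty), (∀ α ∈ Γ, α.IsLt ∧ α.IsSentence) ∧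
    ∀ (X : Type u) [Nonempty X] [TopologicalSpace X], K X ↔ ∀ α ∈ Γ, SpaceModels X α

/-! ## The hybrid language `H(E)` -/

/-- Formulas of the hybrid language `H(E)`.  Propositional letters and nominals are two disjoint
countably infinite supplies of symbols, each indexed by `ℕ`. -/
inductive HEFormula : Type
  | top : HEFormula
  | prop (p : ℕ) : HEFormula
  | nom (i : ℕ) : HEFormula
  | and (φ ψ : HEFormula) : HEFormula
  | neg (φ : HEFormula) : HEFormula
  | box (φ : HEFormula) : HEFormula
  /-- `@_i φ` -/
  | atNom (i : ℕ) (φ : HEFormula) : HEFormula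
  /-- `E φ`, the global modality -/
  | glob (φ : HEFormula) : HEFormula

namespace HEFormula

/-- Truth of an `H(E)`-formula at a point of a hybrid topological model.  The valuation sends the
propositional letter `p` to the set `ν p`, and the nominal `i` to the singleton `{N i}`. -/
def Sat {X : Type u} [TopologicalSpace X] (ν : ℕ → Set X) (N : ℕ → X) : HEFormula → X → Prop
  | top, _ => True
  | prop p, w => w ∈ ν p
  | nom i, w => w = N i
  | and φ ψ, w => Sat ν N φ w ∧ Sat ν N ψ w
  | neg φ, w => ¬ Sat ν N φ w
  | box φ, w => ∃ O : Set X, IsOpen O ∧ w ∈ O ∧ ∀ v ∈ O, Sat ν N φ v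
  | atNom i φ, _ => Sat ν N φ (N i)
  | glob φ, _ => ∃ v, Sat ν N φ v

/-- A formula is valid in a space if it is true at all points under all valuations that assign
singletons to the nominals. -/
def ValidIn (X : Type u) [TopologicalSpace X] (φ : HEFormula) : Prop :=
  ∀ (ν : ℕ → Set X) (N : ℕ → X) (w : X), Sat ν N φ w

end HEFormula

/-- A class of spaces is definable in `H(E)` if it is the class of all spaces in which every member
of some set of `H(E)`-formulas is valid. -/
def HEDefinable (K : SpaceClass.{u}) : Prop :=
  ∃ Γ : Set HEFormula,
    ∀ (X : Type u) [Nonempty X] [TopologicalSpace X], K X ↔ ∀ φ ∈ Γ, φ.ValidIn X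

/-! ## Alexandroff extensions and topological ultrafilter morphic images -/

/-- A filter on a space is open if it contains the interior of each of its members. -/
def IsOpenFilter {Y : Type u} [TopologicalSpace Y] (F : Filter Y) : Prop :=
  ∀ A ∈ F, interior A ∈ F

/-- The underlying set of the Alexandroff extension `Y*`: the set of ultrafilters over `Y`.  (A
separate type, as it does not carry the usual Stone topology on ultrafilters.) -/
def AlexExt (Y : Type u) : Type u := Ultrafilter Y

/-- The topology of the Alexandroff extension is generated by the sets
`{𝔲 | F ⊆ 𝔲}` for the open filters `F` on `Y`. -/
instance AlexExt.instTopologicalSpace (Y : Type u) [TopologicalSpace Y] :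
    TopologicalSpace (AlexExt Y) :=
  TopologicalSpace.generateFrom
    {O : Set (Ultrafilter Y) | ∃ F : Filter Y, IsOpenFilter F ∧
      O = {𝔲 : Ultrafilter Y | ∀ A ∈ F, A ∈ 𝔲}}

/-- The principal ultrafilter of a point, as a point of the Alexandroff extension. -/
def AlexExt.principal {Y : Type u} (y : Y) : AlexExt Y := (pure y : Ultrafilter Y)

/-- `Y` is a topological ultrafilter morphic image of `X`: there is a surjective interior (i.e.
continuous and open) map from `X` to the Alexandroff extension of `Y` under which each principal
ultrafilter has exactly one preimage. -/
def IsUMorphicImage (X Y : Type u) [TopologicalSpace X] [TopologicalSpace Y] : Prop :=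
  ∃ f : X → AlexExt Y, Continuous f ∧ IsOpenMap f ∧ Function.Surjective f ∧
    ∀ y : Y, ∃! x : X, f x = AlexExt.principal y

/-- The class `K` contains all topological ultrafilter morphic images of its members. -/
def ClosedUnderUMorphicImages (K : SpaceClass.{u}) : Prop :=
  ∀ (X Y : Type u) [Nonempty X] [Nonempty Y] [TopologicalSpace X] [TopologicalSpace Y],
    K X → IsUMorphicImage X Y → K Y

/-!
Validity of `H(E)`-formulas passes from `X` to its ultrafilter morphic images `Y`: a valuation on
`Y` extends to `Y*` by letting an ultrafilter satisfy a letter when it contains its value, an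
ultrafilter then satisfies a formula exactly when it contains its truth set
(`AlexExt.interior_mem_iff` is the case of `□`), and truth is reflected along the continuous open
map `f : X → Y*`.  As nominals denote principal ultrafilters, their preimages are singletons
(`HEFormula.sat_iff_mem_of_interior_map`).

Conversely, let `K` be defined by a set of `L_t`-sentences and closed under ultrafilter morphic
images, and let `Y` validate every hybrid formula valid in `K`.  For each finite family `S` of
subsets of `Y`, a space `X S` in `K` carries sets `ν A`, for `A ∈ S`, that respect the Boolean
operations, interiors, non-empty sets and singletons as far as `S` goes
(`HEFormula.exists_isPartialRepresentation`); otherwise a hybrid formula refuted in `Y` would be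
valid in `K`.  An ultraproduct of the spaces `X S` represents all subsets of `Y` by sets `P A`, and
if it is sufficiently saturated, then `x ↦ {A | x ∈ P A}` is a continuous open map onto `Y*`, with
one preimage for each principal ultrafilter (`isUMorphicImage_of_saturated_representation`).

The saturated model is obtained in one step as a limit ultraproduct.  Its points are classes of
functions on `I₀ × (ℕ → I)` that depend on finitely many of the coordinates in `I`, modulo an
ultrafilter in which the quantifier over a later coordinate precedes the quantifiers over the
earlier ones (`exists_diagonal_ultrafilter`).  With `I` consisting of finite parts of a type, the
first unused coordinate selects the part of the type to be realized.  Łoś's theorem holds for the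
internal open sets (`LimitUltraproduct.realize_iff_eventually`).  These form a base of a topology,
and `L_t`-sentences do not distinguish a base from its topology
(`L2Formula.realize_basis_iff_of_isLt`), so the limit ultraproduct is again in `K`.
-/

/-! ### Invariance properties of formulas of `L²` -/

namespace L2Formula

variable {P : Type v} {X : Type u}

/-- Satisfaction depends only on the values of the free variables. -/
theorem realize_congr (σ : Set (Set X)) (ν : P → Set X) (φ : L2Formula P) :
    ∀ (g g' : ℕ → X) (G G' : ℕ → Set X), (∀ n ∈ φ.freePoints, g n = g' n) →
      (∀ n ∈ φ.freeOpens, G n = G' n) → (Realize σ ν φ g G ↔ Realize σ ν φ g' G') := by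
  induction φ with
  | top => intros; rfl
  | eqPoint x y => intro g g' G G' h _; simp [Realize, h x (by simp [freePoints]),
      h y (by simp [freePoints])]
  | eqOpen U V => intro g g' G G' _ h; simp [Realize, h U (by simp [freeOpens]),
      h V (by simp [freeOpens])]
  | pred p x => intro g g' G G' h _; simp [Realize, h x (by simp [freePoints])]
  | mem x U => intro g g' G G' h h'; simp [Realize, h x (by simp [freePoints]),
      h' U (by simp [freeOpens])]
  | neg φ ih => intro g g' G G' h h'; exact not_congr (ih g g' G G' h h')
  | and φ ψ ih₁ ih₂ =>
    intro g g' G G' h h'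
    exact and_congr (ih₁ g g' G G' (fun n hn => h n (Or.inl hn)) fun n hn => h' n (Or.inl hn))
      (ih₂ g g' G G' (fun n hn => h n (Or.inr hn)) fun n hn => h' n (Or.inr hn))
  | exPoint x φ ih =>
    intro g g' G G' h h'
    refine exists_congr fun d => ih _ _ G G' (fun n hn => ?_) h'
    by_cases hx : n = x
    · simp [hx]
    · simpa [hx] using h n ⟨hn, hx⟩
  | exOpen U φ ih =>
    intro g g' G G' h h'
    refine exists_congr fun O => and_congr_right fun _ => ih g g' _ _ h fun n hn => ?_
    by_cases hU : n = U
    · simp [hU]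
    · simpa [hU] using h' n ⟨hn, hU⟩

/-- A formula that is positive in `U` (`b = true`) is monotone in the value of `U`, and a formula
that is negative in `U` (`b = false`) is antitone in it. -/
theorem realize_mono_of_hasSign (σ : Set (Set X)) (ν : P → Set X) (U : ℕ) (φ : L2Formula P) :
    ∀ (b : Bool), φ.HasSign U b → ∀ (g : ℕ → X) (G : ℕ → Set X) (A B : Set X), A ⊆ B →
      Realize σ ν φ g (Function.update G U (if b then A else B)) →
      Realize σ ν φ g (Function.update G U (if b then B else A)) := by
  induction φ with
  | top => intros; trivial
  | eqPoint x y => intro b _ g G A B _ h; exact h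
  | eqOpen V W => intro b hs g G A B _ h; simpa [Realize, hs.1, hs.2] using h
  | pred p x => intro b _ g G A B _ h; exact h
  | mem x V =>
    intro b hs g G A B hAB h
    by_cases hV : V = U
    · obtain rfl := hs hV
      subst hV
      simp only [Realize, Function.update_self, if_true] at h ⊢
      exact hAB h
    · simpa [Realize, hV] using h
  | neg φ ih =>
    intro b hs g G A B hAB h h'
    apply h
    have := ih (!b) hs g G A B hAB
    cases b <;> simp_all
  | and φ ψ ih₁ ih₂ =>
    intro b hs g G A B hAB h
    exact ⟨ih₁ b hs.1 g G A B hAB h.1, ih₂ b hs.2 g G A B hAB h.2⟩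
  | exPoint x φ ih =>
    rintro b hs g G A B hAB ⟨d, hd⟩
    exact ⟨d, ih b hs _ G A B hAB hd⟩
  | exOpen V φ ih =>
    rintro b hs g G A B hAB ⟨O, hO, h⟩
    refine ⟨O, hO, ?_⟩
    by_cases hV : V = U
    · subst hV
      simpa using h
    · rw [Function.update_comm (Ne.symm hV)] at h ⊢
      exact ih b (hs.resolve_left hV) g _ A B hAB h

/-- Formulas of `L_t` do not distinguish a topology from a base of it: a witness `O` of
`∃ U. (x ε U ∧ α)` may be shrunk to a member of the base, since `α` is negative in `U`. -/
theorem realize_basis_iff_of_isLt [TopologicalSpace X] {σ : Set (Set X)}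
    (hσ : TopologicalSpace.IsTopologicalBasis σ) (ν : P → Set X) {φ : L2Formula P}
    (hφ : φ.IsLt) :
    ∀ (g : ℕ → X) (G : ℕ → Set X),
      Realize σ ν φ g G ↔ Realize {O | IsOpen O} ν φ g G := by
  induction hφ with
  | top | eqPoint | eqOpen | pred | mem => intros; rfl
  | neg _ ih => intro g G; exact not_congr (ih g G)
  | and _ _ ih₁ ih₂ => intro g G; exact and_congr (ih₁ g G) (ih₂ g G)
  | exPoint x _ ih => intro g G; exact exists_congr fun d => ih _ G
  | @allOpen x U α _ hpos ih =>
    intro g G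
    have key (τ : Set (Set X)) : Realize τ ν (allOpen U (imp (mem x U) α)) g G ↔
        ¬ ∃ O ∈ τ, g x ∈ Function.update G U O U ∧
          ¬ Realize τ ν α g (Function.update G U O) := by
      simp only [allOpen, imp, Realize, not_not]
    simp only [key, ih]
    refine not_congr ⟨fun ⟨O, hO, h⟩ => ⟨O, hσ.isOpen hO, h⟩, fun ⟨O, hO, hx, h⟩ => ?_⟩
    rw [Function.update_self] at hx
    obtain ⟨B, hB, hxB, hBO⟩ := hσ.exists_subset_of_mem_open hx hO
    refine ⟨B, hB, by rwa [Function.update_self], fun hα => h ?_⟩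
    exact realize_mono_of_hasSign _ ν U α true hpos g G B O hBO hα
  | @exOpen x U α _ hneg ih =>
    intro g G
    simp only [Realize, ih]
    refine ⟨fun ⟨O, hO, h⟩ => ⟨O, hσ.isOpen hO, h⟩, fun ⟨O, hO, hx, h⟩ => ?_⟩
    rw [Function.update_self] at hx
    obtain ⟨B, hB, hxB, hBO⟩ := hσ.exists_subset_of_mem_open hx hO
    exact ⟨B, hB, by rwa [Function.update_self],
      realize_mono_of_hasSign _ ν U α false hneg g G B O hBO h⟩

end L2Formula

/-! ### Validity of hybrid formulas under ultrafilter morphic images -/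

/-- A point of the Alexandroff extension, seen as an ultrafilter. -/
def AlexExt.toUltrafilter {Y : Type u} (u : AlexExt Y) : Ultrafilter Y := u

/-- The sets `{𝔲 | F ⊆ 𝔲}` for open filters `F` form a base, since the filter generated by two
open filters is open. -/
theorem AlexExt.isTopologicalBasis (Y : Type u) [TopologicalSpace Y] :
    TopologicalSpace.IsTopologicalBasis
      {O : Set (AlexExt Y) | ∃ F : Filter Y, IsOpenFilter F ∧
        O = {𝔲 : Ultrafilter Y | ∀ A ∈ F, A ∈ 𝔲}} := by
  refine ⟨?_, ?_, rfl⟩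
  · rintro _ ⟨F, hF, rfl⟩ _ ⟨F', hF', rfl⟩ u ⟨hu, hu'⟩
    refine ⟨_, ⟨F ⊓ F', ?_, rfl⟩, ?_, ?_⟩
    · intro A hA
      obtain ⟨B, hB, C, hC, rfl⟩ := Filter.mem_inf_iff.1 hA
      rw [interior_inter]
      exact Filter.inter_mem_inf (hF B hB) (hF' C hC)
    · intro A hA
      obtain ⟨B, hB, C, hC, rfl⟩ := Filter.mem_inf_iff.1 hA
      exact Filter.inter_mem (f := (u.toUltrafilter : Filter Y)) (hu B hB) (hu' C hC)
    · exact fun v hv => ⟨fun A hA => hv A (Filter.mem_inf_of_left hA),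
        fun A hA => hv A (Filter.mem_inf_of_right hA)⟩
  · refine Set.sUnion_eq_univ_iff.2 fun u => ⟨_, ⟨⊤, ?_, rfl⟩, ?_⟩
    · rintro A hA
      rw [Filter.mem_top] at hA ⊢
      simp [hA]
    · exact le_top (a := (u.toUltrafilter : Filter Y))

/-- An ultrafilter lies in the interior of the set of ultrafilters containing `A` exactly when it
contains the interior of `A`. -/
theorem AlexExt.interior_mem_iff {Y : Type u} [TopologicalSpace Y] (A : Set Y)
    (u : Ultrafilter Y) :
    interior A ∈ u ↔ ∃ O : Set (AlexExt Y), IsOpen O ∧ u ∈ O ∧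
      ∀ v : Ultrafilter Y, v ∈ O → A ∈ v := by
  constructor
  · intro h
    refine ⟨_, TopologicalSpace.isOpen_generateFrom_of_mem ⟨Filter.principal (interior A),
      ?_, rfl⟩, ?_, fun v hv => ?_⟩
    · intro B hB
      exact Filter.mem_principal.2 (interior_maximal (Filter.mem_principal.1 hB) isOpen_interior)
    · intro B hB
      exact Filter.mem_of_superset h (Filter.mem_principal.1 hB)
    · exact Filter.mem_of_superset (hv _ (Filter.mem_principal_self _)) interior_subset
  · rintro ⟨O, hO, hu, h⟩
    obtain ⟨_, ⟨F, hF, rfl⟩, huF, hFO⟩ :=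
      (AlexExt.isTopologicalBasis Y).exists_subset_of_mem_open hu hO
    have hA : A ∈ F := Filter.mem_iff_ultrafilter.2 fun v hv => h v (hFO hv)
    exact huF _ (hF A hA)

namespace HEFormula

theorem sat_box_iff {X : Type u} [TopologicalSpace X] {ν : ℕ → Set X} {N : ℕ → X}
    {φ : HEFormula} {w : X} :
    Sat ν N (box φ) w ↔ w ∈ interior {x | Sat ν N φ x} := by
  rw [mem_interior]
  exact ⟨fun ⟨O, hO, hw, h⟩ => ⟨O, h, hO, hw⟩, fun ⟨O, h, hO, hw⟩ => ⟨O, hO, hw, h⟩⟩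

/-- Along a map `f : X → Y*` that is continuous and open, truth of a formula at `x` means that
`f x` contains its truth set in `Y`. -/
theorem sat_iff_mem_of_interior_map {X Y : Type u} [TopologicalSpace X] [TopologicalSpace Y]
    {f : X → AlexExt Y} (hc : Continuous f) (ho : IsOpenMap f)
    (hs : Function.Surjective f) (ν : ℕ → Set Y) (N : ℕ → Y) (N' : ℕ → X)
    (hN : ∀ i x, f x = AlexExt.principal (N i) ↔ x = N' i) (φ : HEFormula) :
    ∀ x, Sat (fun p => {x | ν p ∈ (f x).toUltrafilter}) N' φ x ↔
      {y | Sat ν N φ y} ∈ (f x).toUltrafilter := by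
  induction φ with
  | top =>
    intro x
    exact iff_of_true trivial (Filter.univ_mem' fun _ => trivial)
  | prop p => intro x; rfl
  | nom i =>
    intro x
    change x = N' i ↔ {N i} ∈ (f x).toUltrafilter
    rw [← hN]
    constructor
    · intro h
      rw [h]
      exact Ultrafilter.mem_pure.2 rfl
    · intro h
      exact Ultrafilter.coe_le_coe.1 (Filter.le_pure_iff.2 h)
  | and φ ψ ih₁ ih₂ =>
    intro x
    exact (and_congr (ih₁ x) (ih₂ x)).trans Filter.inter_mem_iff.symm
  | neg φ ih =>
    intro x
    exact (not_congr (ih x)).trans Ultrafilter.compl_mem_iff_notMem.symm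
  | box φ ih =>
    intro x
    have h : {y | Sat ν N φ.box y} = interior {y | Sat ν N φ y} := by
      ext y
      exact sat_box_iff
    rw [h, AlexExt.interior_mem_iff]
    simp only [Sat]
    constructor
    · rintro ⟨O, hO, hx, h⟩
      refine ⟨f '' O, ho O hO, Set.mem_image_of_mem f hx, ?_⟩
      rintro _ ⟨x', hx', rfl⟩
      exact (ih x').1 (h x' hx')
    · rintro ⟨O, hO, hx, h⟩
      exact ⟨f ⁻¹' O, hO.preimage hc, hx, fun v hv => (ih v).2 (h _ hv)⟩
  | atNom i φ ih =>
    intro x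
    have h := ih (N' i)
    rw [(hN i _).2 rfl] at h
    change Sat _ N' φ (N' i) ↔ {y | Sat ν N φ (N i)} ∈ (f x).toUltrafilter
    refine h.trans (Ultrafilter.mem_pure.trans ?_)
    by_cases hφ : Sat ν N φ (N i)
    · exact iff_of_true hφ (Filter.univ_mem' fun _ => hφ)
    · simp only [hφ, Set.mem_ofPred_eq, false_iff, Set.ofPred_false]
      exact Filter.empty_notMem ((f x).toUltrafilter : Filter Y)
  | glob φ ih =>
    intro x
    change (∃ v, Sat _ N' φ v) ↔ {y | ∃ v, Sat ν N φ v} ∈ (f x).toUltrafilter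
    constructor
    · rintro ⟨v, hv⟩
      obtain ⟨y, hy⟩ := Ultrafilter.nonempty_of_mem ((ih v).1 hv)
      exact Filter.univ_mem' fun _ => ⟨y, hy⟩
    · intro h
      obtain ⟨_, y, hy⟩ := Ultrafilter.nonempty_of_mem h
      obtain ⟨v, hv⟩ := hs (AlexExt.principal y)
      refine ⟨v, (ih v).2 ?_⟩
      rw [hv]
      exact Ultrafilter.mem_pure.2 hy

theorem ValidIn.of_isUMorphicImage {X Y : Type u} [TopologicalSpace X] [TopologicalSpace Y]
    {φ : HEFormula} (hφ : φ.ValidIn X) (h : IsUMorphicImage X Y) : φ.ValidIn Y := by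
  obtain ⟨f, hc, ho, hs, hp⟩ := h
  intro ν N w
  choose N' hN' huniq using fun i => hp (N i)
  obtain ⟨x, hx⟩ := hs (AlexExt.principal w)
  have := (sat_iff_mem_of_interior_map hc ho hs ν N N'
    (fun i x => ⟨fun h => huniq i x h, fun h => h ▸ hN' i⟩) φ x).1 (hφ _ N' x)
  rw [hx] at this
  exact Ultrafilter.mem_pure.1 this

end HEFormula

/-! ### Iterated ultrafilters -/

section Tower

variable {I₀ I : Type u}

/-- The ultrafilters obtained from `U₀` on `I₀` by `n` successive ultrapowers with respect to `U`,
realized on the common index set `I₀ × (ℕ → I)`: the quantifier "for almost all" of stage `n` is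
`∀ᶠ i in U` for the coordinates `n - 1, …, 0`, in this order from the outside, followed by
`∀ᶠ s in U₀`; the other coordinates keep the value `d`. -/
def iteratedUltrafilter (U₀ : Ultrafilter I₀) (U : Ultrafilter I) (d : I) :
    ℕ → Ultrafilter (I₀ × (ℕ → I))
  | 0 => U₀.map fun s => (s, fun _ => d)
  | n + 1 => U.bind fun i =>
      (iteratedUltrafilter U₀ U d n).map fun p => (p.1, Function.update p.2 n i)

variable (U₀ : Ultrafilter I₀) (U : Ultrafilter I) (d : I)

theorem eventually_iteratedUltrafilter_succ (n : ℕ) (A : I₀ → (ℕ → I) → Prop) :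
    (∀ᶠ p in (iteratedUltrafilter U₀ U d (n + 1) : Filter (I₀ × (ℕ → I))), A p.1 p.2) ↔
      ∀ᶠ i in (U : Filter I), ∀ᶠ p in (iteratedUltrafilter U₀ U d n : Filter (I₀ × (ℕ → I))),
        A p.1 (Function.update p.2 n i) :=
  Iff.rfl

theorem dependsOn_update {β : Type*} {A : (ℕ → I) → β} {n m : ℕ}
    (hA : DependsOn A (Set.Iio n)) (hm : n ≤ m) (j : ℕ → I) (i : I) :
    A (Function.update j m i) = A j :=
  hA fun _ hk => Function.update_of_ne (ne_of_lt (lt_of_lt_of_le hk hm)) _ _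

theorem eventually_iteratedUltrafilter_of_le {n m : ℕ} (hm : n ≤ m)
    {A : I₀ → (ℕ → I) → Prop} (hA : ∀ s, DependsOn (A s) (Set.Iio n)) :
    (∀ᶠ p in (iteratedUltrafilter U₀ U d m : Filter (I₀ × (ℕ → I))), A p.1 p.2) ↔
      ∀ᶠ p in (iteratedUltrafilter U₀ U d n : Filter (I₀ × (ℕ → I))), A p.1 p.2 := by
  induction m, hm using Nat.le_induction with
  | base => rfl
  | succ m hm ih =>
    simp only [eventually_iteratedUltrafilter_succ, dependsOn_update (hA _) hm,
      Filter.eventually_const, ih]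

/-- The limit of the iterated ultrafilters: it agrees with stage `n` on conditions that depend on
the coordinates below `n` only. -/
noncomputable def limitUltrafilter : Ultrafilter (I₀ × (ℕ → I)) :=
  (Filter.hyperfilter ℕ).bind (iteratedUltrafilter U₀ U d)

theorem eventually_limitUltrafilter_iff {n : ℕ} {A : I₀ → (ℕ → I) → Prop}
    (hA : ∀ s, DependsOn (A s) (Set.Iio n)) :
    (∀ᶠ p in (limitUltrafilter U₀ U d : Filter (I₀ × (ℕ → I))), A p.1 p.2) ↔
      ∀ᶠ p in (iteratedUltrafilter U₀ U d n : Filter (I₀ × (ℕ → I))), A p.1 p.2 := by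
  have h : (∀ᶠ p in (limitUltrafilter U₀ U d : Filter (I₀ × (ℕ → I))), A p.1 p.2) ↔
      ∀ᶠ m in (Filter.hyperfilter ℕ : Filter ℕ),
        ∀ᶠ p in (iteratedUltrafilter U₀ U d m : Filter (I₀ × (ℕ → I))), A p.1 p.2 := Iff.rfl
  have hn : ∀ᶠ m in (Filter.hyperfilter ℕ : Filter ℕ), n ≤ m :=
    Nat.hyperfilter_le_atTop (Filter.eventually_ge_atTop n)
  rw [h, Filter.eventually_congr (hn.mono fun m hm =>
    eventually_iteratedUltrafilter_of_le U₀ U d hm hA), Filter.eventually_const]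

theorem eventually_limitUltrafilter_succ {n : ℕ} {A : I₀ → (ℕ → I) → Prop}
    (hA : ∀ s, DependsOn (A s) (Set.Iio (n + 1))) :
    (∀ᶠ p in (limitUltrafilter U₀ U d : Filter (I₀ × (ℕ → I))), A p.1 p.2) ↔
      ∀ᶠ i in (U : Filter I), ∀ᶠ p in (limitUltrafilter U₀ U d : Filter (I₀ × (ℕ → I))),
        A p.1 (Function.update p.2 n i) := by
  rw [eventually_limitUltrafilter_iff U₀ U d hA, eventually_iteratedUltrafilter_succ]
  refine Filter.eventually_congr (Filter.Eventually.of_forall fun i => ?_)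
  refine (eventually_limitUltrafilter_iff U₀ U d
    (A := fun s j => A s (Function.update j n i)) fun s j j' h => hA s fun k hk => ?_).symm
  rcases eq_or_ne k n with rfl | hkn
  · simp
  · simpa [hkn] using h k (lt_of_le_of_ne (Nat.lt_succ_iff.1 hk) hkn)

/-- There is an ultrafilter on `I₀ × (ℕ → I)` that projects to `U₀`, all of whose coordinates
project to `U`, and which has the following diagonal property: if each condition `R i` depends on
the coordinates below `n` only and holds almost everywhere, then so does the condition `R i` in
which `i` is the value of coordinate `n`.  The last property makes limit ultraproducts
saturated. -/
theorem exists_diagonal_ultrafilter [Nonempty I] :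
    ∃ D : Ultrafilter (I₀ × (ℕ → I)),
      (∀ Q : I₀ → Prop, (∀ᶠ s in (U₀ : Filter I₀), Q s) →
        ∀ᶠ p in (D : Filter (I₀ × (ℕ → I))), Q p.1) ∧
      (∀ (n : ℕ) (Q : I → Prop), (∀ᶠ i in (U : Filter I), Q i) →
        ∀ᶠ p in (D : Filter (I₀ × (ℕ → I))), Q (p.2 n)) ∧
      ∀ (n : ℕ) (R : I → I₀ → (ℕ → I) → Prop), (∀ i s, DependsOn (R i s) (Set.Iio n)) →
        (∀ i, ∀ᶠ p in (D : Filter (I₀ × (ℕ → I))), R i p.1 p.2) →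
          ∀ᶠ p in (D : Filter (I₀ × (ℕ → I))), R (p.2 n) p.1 p.2 := by
  obtain ⟨d⟩ := ‹Nonempty I›
  refine ⟨limitUltrafilter U₀ U d, fun Q hQ => ?_, fun n Q hQ => ?_, fun n R hR h => ?_⟩
  · exact (eventually_limitUltrafilter_iff U₀ U d (n := 0) (A := fun s _ => Q s)
      fun _ _ _ _ => rfl).2 hQ
  · refine (eventually_limitUltrafilter_succ U₀ U d (n := n) (A := fun _ j => Q (j n))
      fun s j j' h => by simp only [h n (Nat.lt_succ_self n)]).2 ?_
    simpa using hQ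
  · refine (eventually_limitUltrafilter_succ U₀ U d (n := n) (A := fun s j => R (j n) s j)
      fun s j j' h => ?_).2 (Filter.Eventually.of_forall fun i => ?_)
    · simp only [h n (Nat.lt_succ_self n)]
      exact hR _ s fun k hk => h k (Nat.lt_succ_of_lt hk)
    · simpa only [Function.update_self, dependsOn_update (hR _ _) le_rfl] using h i

end Tower

/-! ### Limit ultraproducts of spaces -/

/-- Choosing witnesses does not introduce new dependences: if the condition `Q s j` on `x` depends
on the coordinates of `j` in `t` only, then so does some choice of witnesses. -/
theorem exists_dependsOn_witness {I₀ I : Type u} {β : I₀ → Type*} [∀ s, Nonempty (β s)]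
    (Q : ∀ s, (ℕ → I) → β s → Prop) {t : Set ℕ} (hQ : ∀ s, DependsOn (Q s) t) :
    ∃ b : ∀ s, (ℕ → I) → β s, (∀ s, DependsOn (b s) t) ∧ ∀ s j, (∃ x, Q s j x) → Q s j (b s j) :=
  ⟨fun s j => Classical.epsilon (Q s j), fun s _ _ h => congrArg Classical.epsilon (hQ s h),
    fun _ _ h => Classical.epsilon_spec h⟩

section LimitUltraproduct

variable {I₀ I : Type u} (D : Ultrafilter (I₀ × (ℕ → I))) (X : I₀ → Type u)

/-- A family of functions on `ℕ → I` is finitary if some finite set of coordinates determines all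
its members. -/
def Finitary {β : I₀ → Type*} (a : ∀ s, (ℕ → I) → β s) : Prop :=
  ∃ n, ∀ s, DependsOn (a s) (Set.Iio n)

theorem Finitary.exists_common {β γ : I₀ → Type*} {a : ∀ s, (ℕ → I) → β s}
    {b : ∀ s, (ℕ → I) → γ s} (ha : Finitary a) (hb : Finitary b) :
    ∃ n, (∀ s, DependsOn (a s) (Set.Iio n)) ∧ ∀ s, DependsOn (b s) (Set.Iio n) := by
  obtain ⟨n, hn⟩ := ha
  obtain ⟨m, hm⟩ := hb
  exact ⟨max n m, fun s => (hn s).mono (Set.Iio_subset_Iio (le_max_left n m)),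
    fun s => (hm s).mono (Set.Iio_subset_Iio (le_max_right n m))⟩

/-- Almost everywhere equality of finitary functions. -/
def limitUltraproductSetoid : Setoid {a : ∀ s, (ℕ → I) → X s // Finitary a} where
  r a b := ∀ᶠ p in (D : Filter (I₀ × (ℕ → I))), a.1 p.1 p.2 = b.1 p.1 p.2
  iseqv := ⟨fun _ => Filter.Eventually.of_forall fun _ => rfl,
    fun h => h.mono fun _ => Eq.symm,
    fun h h' => h.mp (h'.mono fun _ e' e => e.trans e')⟩

/-- The limit ultraproduct of the sets `X s`: the part of the ultraproduct over `I₀ × (ℕ → I)`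
that consists of the classes of finitary functions.  It is the direct limit of the chain in which
an ultraproduct over `I₀` is followed by iterated ultrapowers over `I`. -/
def LimitUltraproduct : Type u := Quotient (limitUltraproductSetoid D X)

variable {X}

namespace LimitUltraproduct

/-- The class of a finitary function. -/
def mk (a : ∀ s, (ℕ → I) → X s) (ha : Finitary a) : LimitUltraproduct D X :=
  Quotient.mk (limitUltraproductSetoid D X) ⟨a, ha⟩

variable {D}

theorem mk_eq_mk {a b : ∀ s, (ℕ → I) → X s} {ha : Finitary a} {hb : Finitary b} :
    mk D a ha = mk D b hb ↔ ∀ᶠ p in (D : Filter (I₀ × (ℕ → I))), a p.1 p.2 = b p.1 p.2 :=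
  Quotient.eq (r := limitUltraproductSetoid D X)

theorem exists_rep (x : LimitUltraproduct D X) : ∃ a, ∃ ha : Finitary a, mk D a ha = x := by
  obtain ⟨⟨a, ha⟩, rfl⟩ := Quotient.exists_rep x
  exact ⟨a, ha, rfl⟩

variable (D)

/-- The internal subset given by a family of sets. -/
def internal (O : ∀ s, (ℕ → I) → Set (X s)) : Set (LimitUltraproduct D X) :=
  {x | ∃ a, ∃ ha : Finitary a, mk D a ha = x ∧
    ∀ᶠ p in (D : Filter (I₀ × (ℕ → I))), a p.1 p.2 ∈ O p.1 p.2}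

variable {D}

theorem mk_mem_internal {O : ∀ s, (ℕ → I) → Set (X s)} {a : ∀ s, (ℕ → I) → X s}
    {ha : Finitary a} :
    mk D a ha ∈ internal D O ↔
      ∀ᶠ p in (D : Filter (I₀ × (ℕ → I))), a p.1 p.2 ∈ O p.1 p.2 := by
  refine ⟨fun ⟨b, hb, hab, h⟩ => ?_, fun h => ⟨a, ha, rfl, h⟩⟩
  filter_upwards [mk_eq_mk.1 hab, h] with p hp hp'
  rwa [← hp]

theorem internal_mono {O O' : ∀ s, (ℕ → I) → Set (X s)}
    (h : ∀ᶠ p in (D : Filter (I₀ × (ℕ → I))), O p.1 p.2 ⊆ O' p.1 p.2) :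
    internal D O ⊆ internal D O' := by
  rintro _ ⟨a, ha, rfl, h'⟩
  exact mk_mem_internal.2 (h'.mp (h.mono fun p hp hp' => hp hp'))

theorem internal_subset_internal_iff [∀ s, Nonempty (X s)]
    {O O' : ∀ s, (ℕ → I) → Set (X s)} (hO : Finitary O) (hO' : Finitary O') :
    internal D O ⊆ internal D O' ↔
      ∀ᶠ p in (D : Filter (I₀ × (ℕ → I))), O p.1 p.2 ⊆ O' p.1 p.2 := by
  refine ⟨fun h => ?_, internal_mono⟩
  obtain ⟨n, hn, hm⟩ := hO.exists_common hO'
  obtain ⟨b, hb, hb'⟩ := exists_dependsOn_witness (fun s j x => x ∈ O s j ∧ x ∉ O' s j)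
    (t := Set.Iio n) fun s j j' h => by
      simp only [hn s h, hm s h]
  by_contra hne
  rw [← Ultrafilter.eventually_not] at hne
  have key : ∀ᶠ p in (D : Filter (I₀ × (ℕ → I))),
      b p.1 p.2 ∈ O p.1 p.2 ∧ b p.1 p.2 ∉ O' p.1 p.2 :=
    hne.mono fun p hp => hb' p.1 p.2 (Set.not_subset.1 hp)
  have := mk_mem_internal.1 (h ((mk_mem_internal (ha := ⟨_, hb⟩)).2 (key.mono fun _ h => h.1)))
  obtain ⟨p, hp, hp'⟩ := (key.and this).exists
  exact hp.2 hp'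

theorem internal_eq_internal_iff [∀ s, Nonempty (X s)]
    {O O' : ∀ s, (ℕ → I) → Set (X s)} (hO : Finitary O) (hO' : Finitary O') :
    internal D O = internal D O' ↔
      ∀ᶠ p in (D : Filter (I₀ × (ℕ → I))), O p.1 p.2 = O' p.1 p.2 := by
  simp only [Set.Subset.antisymm_iff, internal_subset_internal_iff hO hO',
    internal_subset_internal_iff hO' hO, Filter.eventually_and]

variable (D X) [∀ s, TopologicalSpace (X s)]

/-- The internal sets given by finitary families of open sets.  They form the base of the topology
of the limit ultraproduct. -/
def internalOpens : Set (Set (LimitUltraproduct D X)) :=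
  {S | ∃ O : ∀ s, (ℕ → I) → Set (X s), Finitary O ∧
    (∀ᶠ p in (D : Filter (I₀ × (ℕ → I))), IsOpen (O p.1 p.2)) ∧ internal D O = S}

instance : TopologicalSpace (LimitUltraproduct D X) :=
  TopologicalSpace.generateFrom (internalOpens D X)

theorem univ_mem_internalOpens : Set.univ ∈ internalOpens D X := by
  refine ⟨fun _ _ => Set.univ, ⟨0, fun _ _ _ _ => rfl⟩, by simp, ?_⟩
  refine Set.eq_univ_of_forall fun x => ?_
  obtain ⟨a, ha, rfl⟩ := exists_rep x
  exact mk_mem_internal.2 (by simp)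

theorem isTopologicalBasis_internalOpens :
    TopologicalSpace.IsTopologicalBasis (internalOpens D X) := by
  refine ⟨?_, Set.sUnion_eq_univ_iff.2 fun x => ⟨_, univ_mem_internalOpens D X, trivial⟩, rfl⟩
  rintro _ ⟨O, hO, ho, rfl⟩ _ ⟨O', hO', ho', rfl⟩ x hx
  obtain ⟨n, hn, hm⟩ := hO.exists_common hO'
  refine ⟨_, ⟨fun s j => O s j ∩ O' s j, ⟨n, fun s j j' h => ?_⟩, ?_, rfl⟩, ?_, ?_⟩
  · simp only [hn s h, hm s h]
  · filter_upwards [ho, ho'] with p h h' using h.inter h'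
  · obtain ⟨a, ha, rfl⟩ := exists_rep x
    exact mk_mem_internal.2 ((mk_mem_internal.1 hx.1).and (mk_mem_internal.1 hx.2))
  · exact Set.subset_inter (internal_mono (by simp)) (internal_mono (by simp))

variable {D X}

variable [∀ s, Nonempty (X s)]

instance instNonempty : Nonempty (LimitUltraproduct D X) :=
  ⟨mk D (fun _ _ => Classical.arbitrary _) ⟨0, fun _ _ _ _ => rfl⟩⟩

/-- Łoś's theorem for limit ultraproducts, the open variables ranging over the internal open sets.
The assignments must be represented by families that are determined by a common finite set of
coordinates, so that the witnesses chosen for the quantifiers are finitary too. -/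
theorem realize_iff_eventually {P : Type v} (ν : ∀ s, P → Set (X s)) (φ : L2Formula P) :
    ∀ (n : ℕ) (g : ℕ → ∀ s, (ℕ → I) → X s) (G : ℕ → ∀ s, (ℕ → I) → Set (X s))
      (hg : ∀ x s, DependsOn (g x s) (Set.Iio n)), (∀ U s, DependsOn (G U s) (Set.Iio n)) →
      (φ.Realize (internalOpens D X) (fun p => internal D fun s _ => ν s p)
          (fun x => mk D (g x) ⟨n, hg x⟩) (fun U => internal D (G U)) ↔
        ∀ᶠ p in (D : Filter (I₀ × (ℕ → I))), φ.Realize {O | IsOpen O} (ν p.1)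
          (fun x => g x p.1 p.2) (fun U => G U p.1 p.2)) := by
  induction φ with
  | top => intros; simp [L2Formula.Realize]
  | eqPoint x y => intro n g G hg hG; exact mk_eq_mk
  | eqOpen U V =>
    intro n g G hg hG
    exact internal_eq_internal_iff ⟨n, hG U⟩ ⟨n, hG V⟩
  | pred p x => intro n g G hg hG; exact mk_mem_internal
  | mem x U => intro n g G hg hG; exact mk_mem_internal
  | neg φ ih =>
    intro n g G hg hG
    exact (not_congr (ih n g G hg hG)).trans Ultrafilter.eventually_not.symm
  | and φ ψ ih₁ ih₂ =>
    intro n g G hg hG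
    exact (and_congr (ih₁ n g G hg hG) (ih₂ n g G hg hG)).trans Filter.eventually_and.symm
  | exPoint x φ ih =>
    intro n g G hg hG
    have step (m : ℕ) (hm : n ≤ m) (b : ∀ s, (ℕ → I) → X s)
        (hb : ∀ s, DependsOn (b s) (Set.Iio m)) :
        φ.Realize (internalOpens D X) (fun p => internal D fun s _ => ν s p)
          (Function.update (fun x => mk D (g x) ⟨n, hg x⟩) x (mk D b ⟨m, hb⟩))
          (fun U => internal D (G U)) ↔
        ∀ᶠ p in (D : Filter (I₀ × (ℕ → I))), φ.Realize {O | IsOpen O} (ν p.1)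
          (Function.update (fun x => g x p.1 p.2) x (b p.1 p.2)) (fun U => G U p.1 p.2) := by
      have h' : ∀ y s, DependsOn (Function.update g x b y s) (Set.Iio m) := by
        intro y s
        rcases eq_or_ne y x with rfl | hy
        · simpa using hb s
        · simpa [hy] using (hg y s).mono (Set.Iio_subset_Iio hm)
      convert ih m (Function.update g x b) G h'
        (fun U s => (hG U s).mono (Set.Iio_subset_Iio hm)) using 2
      · ext y
        rcases eq_or_ne y x with rfl | hy
        · simp
        · simp [hy]
      · ext p
        congr! 1
        ext y
        rcases eq_or_ne y x with rfl | hy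
        · simp
        · simp [hy]
    constructor
    · rintro ⟨d, hd⟩
      obtain ⟨b, ⟨m, hb⟩, rfl⟩ := exists_rep d
      have hb' : ∀ s, DependsOn (b s) (Set.Iio (max n m)) := fun s =>
        (hb s).mono (Set.Iio_subset_Iio (le_max_right n m))
      exact ((step _ (le_max_left n m) b hb').1 hd).mono fun p hp => ⟨_, hp⟩
    · intro h
      obtain ⟨b, hb, hb'⟩ := exists_dependsOn_witness (fun s (j : ℕ → I) d =>
        φ.Realize {O | IsOpen O} (ν s) (Function.update (fun x => g x s j) x d)
          (fun U => G U s j)) (t := Set.Iio n) fun s j j' h => by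
            simp only [fun x => hg x s h, fun U => hG U s h]
      exact ⟨_, (step n le_rfl b hb).2 (h.mono fun p hp => hb' p.1 p.2 hp)⟩
  | exOpen U φ ih =>
    intro n g G hg hG
    have step (m : ℕ) (hm : n ≤ m) (b : ∀ s, (ℕ → I) → Set (X s))
        (hb : ∀ s, DependsOn (b s) (Set.Iio m)) :
        φ.Realize (internalOpens D X) (fun p => internal D fun s _ => ν s p)
          (fun x => mk D (g x) ⟨n, hg x⟩)
          (Function.update (fun U => internal D (G U)) U (internal D b)) ↔
        ∀ᶠ p in (D : Filter (I₀ × (ℕ → I))), φ.Realize {O | IsOpen O} (ν p.1)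
          (fun x => g x p.1 p.2) (Function.update (fun U => G U p.1 p.2) U (b p.1 p.2)) := by
      have h' : ∀ V s, DependsOn (Function.update G U b V s) (Set.Iio m) := by
        intro V s
        rcases eq_or_ne V U with rfl | hV
        · simpa using hb s
        · simpa [hV] using (hG V s).mono (Set.Iio_subset_Iio hm)
      convert ih m g (Function.update G U b)
        (fun x s => (hg x s).mono (Set.Iio_subset_Iio hm)) h' using 2
      · ext1 V
        rcases eq_or_ne V U with rfl | hV
        · simp
        · simp [hV]
      · ext p
        congr! 1
        ext1 V
        rcases eq_or_ne V U with rfl | hV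
        · simp
        · simp [hV]
    constructor
    · rintro ⟨_, ⟨b, ⟨m, hb⟩, ho, rfl⟩, hd⟩
      have hb' : ∀ s, DependsOn (b s) (Set.Iio (max n m)) := fun s =>
        (hb s).mono (Set.Iio_subset_Iio (le_max_right n m))
      filter_upwards [ho, (step _ (le_max_left n m) b hb').1 hd] with p h h' using ⟨_, h, h'⟩
    · intro h
      obtain ⟨b, hb, hb'⟩ := exists_dependsOn_witness (fun s (j : ℕ → I) O => IsOpen O ∧
        φ.Realize {O | IsOpen O} (ν s) (fun x => g x s j)
          (Function.update (fun U => G U s j) U O)) (t := Set.Iio n) fun s j j' h => by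
            simp only [fun x => hg x s h, fun U => hG U s h]
      have hb'' := h.mono fun p hp => hb' p.1 p.2 hp
      exact ⟨_, ⟨b, ⟨n, hb⟩, hb''.mono fun _ h => h.1, rfl⟩,
        (step n le_rfl b hb).2 (hb''.mono fun _ h => h.2)⟩

/-- Truth of `L_t`-sentences passes to limit ultraproducts. -/
theorem spaceModels {φ : L2Formula Empty} (hφ : φ.IsLt) (hs : φ.IsSentence)
    (h : ∀ s, SpaceModels (X s) φ) : SpaceModels (LimitUltraproduct D X) φ := by
  intro g G _
  rw [← L2Formula.realize_basis_iff_of_isLt (isTopologicalBasis_internalOpens D X) _ hφ]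
  have key := (realize_iff_eventually (D := D) (fun s (p : Empty) => p.elim) φ 0
    (fun _ _ _ => Classical.arbitrary _) (fun _ _ _ => ∅) (fun _ _ _ _ _ => rfl)
    (fun _ _ _ _ _ => rfl)).2 (Filter.Eventually.of_forall fun p => h p.1 _ _ fun _ => isOpen_empty)
  convert (L2Formula.realize_congr _ _ φ _ g _ G (by simp [hs.1]) (by simp [hs.2])).1 key

end LimitUltraproduct

end LimitUltraproduct

/-! ### Representations of a space by families of sets -/

/-- Let `P` represent the subsets of `Y` by subsets of `M`, compatibly with the Boolean operations
and with interiors, and let the representation be saturated with respect to a base of `M`: if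
`x ∈ P A` for all members `A` of an open filter, then `x` has a basic neighbourhood inside all these
`P A`, and each basic open set that meets all `P A`, for `A` in an ultrafilter, contains a
common point of them.  Then `x ↦ {A | x ∈ P A}` presents `Y` as an ultrafilter morphic image
of `M`. -/
theorem isUMorphicImage_of_saturated_representation {M Y : Type u} [TopologicalSpace M]
    [TopologicalSpace Y] {σ : Set (Set M)} (hσ : TopologicalSpace.IsTopologicalBasis σ)
    (huniv : Set.univ ∈ σ) (P : Set Y → Set M) (P_univ : P Set.univ = Set.univ)
    (P_inter : ∀ A B, P (A ∩ B) = P A ∩ P B) (P_compl : ∀ A, P Aᶜ = (P A)ᶜ)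
    (P_interior : ∀ A, ∀ O ∈ σ, O ⊆ P A → O ⊆ P (interior A))
    (P_nonempty : ∀ A, A.Nonempty → (P A).Nonempty)
    (P_singleton : ∀ y, (P {y}).Subsingleton)
    (saturated_nhds : ∀ F : Filter Y, IsOpenFilter F → ∀ x, (∀ A ∈ F, x ∈ P A) →
      ∃ O ∈ σ, x ∈ O ∧ ∀ A ∈ F, O ⊆ P A)
    (saturated_points : ∀ u : Ultrafilter Y, ∀ O ∈ σ, (∀ A ∈ u, (O ∩ P A).Nonempty) →
      ∃ x ∈ O, ∀ A ∈ u, x ∈ P A) :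
    IsUMorphicImage M Y := by
  have P_mono {A B : Set Y} (h : A ⊆ B) : P A ⊆ P B := by
    rw [← Set.inter_eq_left.2 h, P_inter]
    exact Set.inter_subset_right
  let f (x : M) : Ultrafilter Y := Ultrafilter.ofComplNotMemIff
    { sets := {A | x ∈ P A}
      univ_sets := by simp [P_univ]
      sets_of_superset := fun hA hAB => P_mono hAB hA
      inter_sets := fun {A B} hA hB => (P_inter A B).ge ⟨hA, hB⟩ }
    fun A => by
      change x ∉ P Aᶜ ↔ x ∈ P A
      simp [P_compl]
  have mem_f {x : M} {A : Set Y} : A ∈ f x ↔ x ∈ P A := Iff.rfl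
  have eq_f {x : M} {u : Ultrafilter Y} (h : ∀ A ∈ u, x ∈ P A) : f x = u :=
    Ultrafilter.coe_le_coe.1 fun A hA => h A hA
  have f_surj (u : Ultrafilter Y) : ∃ x, f x = u := by
    obtain ⟨x, -, hx⟩ := saturated_points u Set.univ huniv fun A hA => by
      rw [Set.univ_inter]
      exact P_nonempty A (Ultrafilter.nonempty_of_mem hA)
    exact ⟨x, eq_f hx⟩
  refine ⟨f, ?_, ?_, f_surj, fun y => ?_⟩
  · refine continuous_generateFrom_iff.2 ?_
    rintro _ ⟨F, hF, rfl⟩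
    refine isOpen_iff_forall_mem_open.2 fun x hx => ?_
    obtain ⟨O, hO, hxO, h⟩ := saturated_nhds F hF x hx
    exact ⟨O, fun z hz A hA => h A hA hz, hσ.isOpen hO, hxO⟩
  · refine hσ.isOpenMap_iff.2 fun O hO => ?_
    -- The image of a basic open set `O` is determined by the open filter of all `A` with `O ⊆ P A`.
    let F : Filter Y :=
      { sets := {A | O ⊆ P A}
        univ_sets := by simp [P_univ]
        sets_of_superset := fun hA hAB => Set.Subset.trans hA (P_mono hAB)
        inter_sets := fun {A B} hA hB => (Set.subset_inter hA hB).trans (P_inter A B).ge }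
    have hF : f '' O = {u : Ultrafilter Y | ∀ A ∈ F, A ∈ u} := by
      ext u
      constructor
      · rintro ⟨x, hx, rfl⟩ A hA
        exact hA hx
      · intro hu
        obtain ⟨x, hx, h⟩ := saturated_points u O hO fun A hA => by
          by_contra hne
          rw [Set.not_nonempty_iff_eq_empty, ← Set.disjoint_iff_inter_eq_empty] at hne
          have : Aᶜ ∈ u := hu Aᶜ ((Set.subset_compl_iff_disjoint_right.2 hne).trans (P_compl A).ge)
          exact Ultrafilter.compl_mem_iff_notMem.1 this hA
        exact ⟨x, hx, eq_f h⟩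
    exact TopologicalSpace.isOpen_generateFrom_of_mem ⟨F, fun A hA => P_interior A O hO hA, hF⟩
  · obtain ⟨x, hx⟩ := f_surj (pure y)
    have key {z : M} (hz : f z = pure y) : z ∈ P {y} := by
      rw [← mem_f, hz]
      exact Ultrafilter.mem_pure.2 rfl
    exact ⟨x, hx, fun z hz => P_singleton y (key hz) (key hx)⟩

/-- The map `ν` from subsets of `Y` to subsets of `X` respects the Boolean operations, interiors,
non-empty sets and singletons as far as only members of `S` are concerned. -/
structure IsPartialRepresentation {X Y : Type u} [TopologicalSpace X] [TopologicalSpace Y]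
    (S : Finset (Set Y)) (ν : Set Y → Set X) : Prop where
  univ : Set.univ ∈ S → ν Set.univ = Set.univ
  inter : ∀ A ∈ S, ∀ B ∈ S, A ∩ B ∈ S → ν (A ∩ B) = ν A ∩ ν B
  compl : ∀ A ∈ S, Aᶜ ∈ S → ν Aᶜ = (ν A)ᶜ
  interior : ∀ A ∈ S, interior A ∈ S → ν (interior A) = interior (ν A)
  nonempty : ∀ A ∈ S, A.Nonempty → (ν A).Nonempty
  subsingleton : ∀ y, {y} ∈ S → (ν {y}).Subsingleton

/-- Partial representations of `Y` for all finite families of subsets of `Y` yield a saturated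
representation in a limit ultraproduct. -/
theorem isUMorphicImage_limitUltraproduct {Y : Type u} [TopologicalSpace Y]
    {X : Finset (Set Y) → Type u} [∀ S, Nonempty (X S)] [∀ S, TopologicalSpace (X S)]
    {ν : ∀ S, Set Y → Set (X S)} (hν : ∀ S, IsPartialRepresentation S (ν S)) :
    ∃ D : Ultrafilter (Finset (Set Y) × (ℕ → Finset (Set Y))),
      IsUMorphicImage (LimitUltraproduct D X) Y := by
  obtain ⟨U, hU⟩ := Ultrafilter.exists_le (Filter.atTop : Filter (Finset (Set Y)))
  obtain ⟨D, hD₀, hD, hdiag⟩ := exists_diagonal_ultrafilter U U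
  have hmem_U (A : Set Y) : ∀ᶠ S in (U : Filter (Finset (Set Y))), A ∈ S :=
    hU ((Filter.eventually_ge_atTop {A}).mono fun S hS => hS (Finset.mem_singleton_self A))
  have hmem (A : Set Y) := hD₀ _ (hmem_U A)
  have hcoord (n : ℕ) (A : Set Y) := hD n _ (hmem_U A)
  have hfin (A : Set Y) : Finitary (I := Finset (Set Y)) fun S _ => ν S A :=
    ⟨0, fun _ _ _ _ => rfl⟩
  refine ⟨D, isUMorphicImage_of_saturated_representation
    (LimitUltraproduct.isTopologicalBasis_internalOpens D X)
    (LimitUltraproduct.univ_mem_internalOpens D X)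
    (fun A => LimitUltraproduct.internal D fun S _ => ν S A)
    ?_ ?_ ?_ ?_ ?_ ?_ ?_ ?_⟩
  · refine Set.eq_univ_of_forall fun x => ?_
    obtain ⟨a, ha, rfl⟩ := LimitUltraproduct.exists_rep x
    refine LimitUltraproduct.mk_mem_internal.2 ((hmem Set.univ).mono fun p hp => ?_)
    rw [(hν p.1).univ hp]
    trivial
  · intro A B
    ext x
    obtain ⟨a, ha, rfl⟩ := LimitUltraproduct.exists_rep x
    rw [Set.mem_inter_iff]
    simp only [LimitUltraproduct.mk_mem_internal, ← Filter.eventually_and]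
    refine Filter.eventually_congr ?_
    filter_upwards [hmem A, hmem B, hmem (A ∩ B)] with p h₁ h₂ h₃
    rw [(hν p.1).inter A h₁ B h₂ h₃, Set.mem_inter_iff]
  · intro A
    ext x
    obtain ⟨a, ha, rfl⟩ := LimitUltraproduct.exists_rep x
    rw [Set.mem_compl_iff]
    simp only [LimitUltraproduct.mk_mem_internal, ← Ultrafilter.eventually_not]
    refine Filter.eventually_congr ?_
    filter_upwards [hmem A, hmem Aᶜ] with p h₁ h₂
    rw [(hν p.1).compl A h₁ h₂, Set.mem_compl_iff]
  · rintro A _ ⟨O, hO, ho, rfl⟩ hOA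
    refine LimitUltraproduct.internal_mono ?_
    filter_upwards [hmem A, hmem (interior A), ho,
      (LimitUltraproduct.internal_subset_internal_iff hO (hfin A)).1 hOA] with p h₁ h₂ h₃ h₄
    rw [(hν p.1).interior A h₁ h₂]
    exact interior_maximal h₄ h₃
  · intro A hA
    obtain ⟨b, hb, hb'⟩ := exists_dependsOn_witness
      (fun S (_ : ℕ → Finset (Set Y)) x => x ∈ ν S A) (t := Set.Iio 0) fun _ _ _ _ => rfl
    exact ⟨LimitUltraproduct.mk D b ⟨0, hb⟩, LimitUltraproduct.mk_mem_internal.2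
      ((hmem A).mono fun p hp => hb' p.1 p.2 ((hν p.1).nonempty A hp hA))⟩
  · rintro y x hx x' hx'
    obtain ⟨a, ha, rfl⟩ := LimitUltraproduct.exists_rep x
    obtain ⟨a', ha', rfl⟩ := LimitUltraproduct.exists_rep x'
    refine LimitUltraproduct.mk_eq_mk.2 ?_
    filter_upwards [hmem {y}, LimitUltraproduct.mk_mem_internal.1 hx,
      LimitUltraproduct.mk_mem_internal.1 hx'] with p h₁ h₂ h₃
    exact (hν p.1).subsingleton y h₁ h₂ h₃
  · intro F hF x hx
    obtain ⟨a, ⟨n, hn⟩, rfl⟩ := LimitUltraproduct.exists_rep x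
    -- Coordinate `n` lists the finitely many members of `F` to be taken into account.
    refine ⟨_, ⟨fun S j => {z | ∀ A ∈ j n, A ∈ F → z ∈ interior (ν S A)},
      ⟨n + 1, fun S j j' h => ?_⟩, Filter.Eventually.of_forall fun p => ?_, rfl⟩, ?_, ?_⟩
    · simp only [h n (Nat.lt_succ_self n)]
    · have : {z | ∀ A ∈ p.2 n, A ∈ F → z ∈ interior (ν p.1 A)} =
          ⋂ A ∈ p.2 n, ⋂ _ : A ∈ F, interior (ν p.1 A) := by
        ext z
        simp
      exact (congrArg IsOpen this).mpr (isOpen_biInter_finset fun A _ =>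
        isOpen_iInter_of_finite fun _ => isOpen_interior)
    · refine LimitUltraproduct.mk_mem_internal.2 (hdiag n
        (fun i S j => ∀ A ∈ i, A ∈ F → a S j ∈ interior (ν S A)) (fun i S j j' h => ?_)
        fun i => ?_)
      · simp only [hn S h]
      · refine (Filter.eventually_all_finset i).2 fun A _ => Filter.eventually_imp_distrib_left.2
          fun hA => ?_
        filter_upwards [hmem A, hmem (interior A),
          LimitUltraproduct.mk_mem_internal.1 (hx _ (hF A hA))] with p h₁ h₂ h₃
        rwa [(hν p.1).interior A h₁ h₂] at h₃
    · intro A hA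
      exact LimitUltraproduct.internal_mono ((hcoord n A).mono fun p hp z hz =>
        interior_subset (hz A hp hA))
  · rintro u _ ⟨O, ⟨n, hn⟩, -, rfl⟩ h
    have hOA (A : Set Y) (hA : A ∈ u) :
        ∀ᶠ p in (D : Filter (Finset (Set Y) × (ℕ → Finset (Set Y)))), (O p.1 p.2 ∩ ν p.1 A).Nonempty := by
      obtain ⟨x, hx, hx'⟩ := h A hA
      obtain ⟨a, ha, rfl⟩ := LimitUltraproduct.exists_rep x
      filter_upwards [LimitUltraproduct.mk_mem_internal.1 hx,
        LimitUltraproduct.mk_mem_internal.1 hx'] with p h₁ h₂ using ⟨_, h₁, h₂⟩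
    -- Coordinate `n` lists the finitely many members of `u` to be taken into account.
    have key := hdiag n (fun i S j => ∃ x ∈ O S j, ∀ A ∈ i, A ∈ u → x ∈ ν S A)
      (fun i S j j' h => by simp only [hn S h]) fun i => by
        have hB : ⋂ A ∈ i, ⋂ _ : A ∈ u, A ∈ u :=
          (Filter.biInter_finset_mem i).2 fun A _ => Filter.iInter_mem.2 id
        have hsub : ∀ᶠ p in (D : Filter (Finset (Set Y) × (ℕ → Finset (Set Y)))), ∀ A ∈ i, A ∈ u →
            ν p.1 (⋂ A ∈ i, ⋂ _ : A ∈ u, A) ⊆ ν p.1 A := by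
          refine (Filter.eventually_all_finset i).2 fun A hAi =>
            Filter.eventually_imp_distrib_left.2 fun hA => ?_
          have hle : (⋂ A ∈ i, ⋂ _ : A ∈ u, A) ⊆ A := fun y hy => by
            simp only [Set.mem_iInter] at hy
            exact hy A hAi hA
          filter_upwards [hmem A, hmem (⋂ A ∈ i, ⋂ _ : A ∈ u, A)] with p h₁ h₂
          have h₃ := (hν p.1).inter _ h₂ A h₁ (by rwa [Set.inter_eq_left.2 hle])
          rw [Set.inter_eq_left.2 hle] at h₃
          exact Set.inter_eq_left.1 h₃.symm
        filter_upwards [hOA _ hB, hsub] with p ⟨x, hx, hx'⟩ h₂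
        exact ⟨x, hx, fun A hAi hA => h₂ A hAi hA hx'⟩
    obtain ⟨b, hb, hb'⟩ := exists_dependsOn_witness
      (fun S (j : ℕ → Finset (Set Y)) x => x ∈ O S j ∧ ∀ A ∈ j n, A ∈ u → x ∈ ν S A)
      (t := Set.Iio (n + 1)) fun S j j' h => by
        simp only [hn S fun k hk => h k (Nat.lt_succ_of_lt hk), h n (Nat.lt_succ_self n)]
    have hb'' := key.mono fun p hp => hb' p.1 p.2 hp
    refine ⟨LimitUltraproduct.mk D b ⟨n + 1, hb⟩,
      LimitUltraproduct.mk_mem_internal.2 (hb''.mono fun _ h => h.1), fun A hA => ?_⟩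
    refine LimitUltraproduct.mk_mem_internal.2 ?_
    filter_upwards [hb'', hcoord n A] with p h₁ h₂ using h₁.2 A h₂ hA

/-! ### Finite fragments of the hybrid theory of a space -/

namespace HEFormula

/-- The biconditional of two formulas. -/
def biimp (φ ψ : HEFormula) : HEFormula := and (neg (and φ (neg ψ))) (neg (and ψ (neg φ)))

theorem sat_biimp {X : Type u} [TopologicalSpace X] {ν : ℕ → Set X} {N : ℕ → X}
    {φ ψ : HEFormula} {w : X} :
    Sat ν N (biimp φ ψ) w ↔ (Sat ν N φ w ↔ Sat ν N ψ w) := by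
  simp only [biimp, Sat]
  tauto

theorem exists_conj {Φ : Set HEFormula} (hΦ : Φ.Finite) :
    ∃ c : HEFormula, ∀ (X : Type u) [TopologicalSpace X] (ν : ℕ → Set X) (N : ℕ → X) (w : X),
      Sat ν N c w ↔ ∀ φ ∈ Φ, Sat ν N φ w := by
  induction Φ, hΦ using Set.Finite.induction_on with
  | empty => exact ⟨top, by simp [Sat]⟩
  | @insert φ Φ _ _ ih =>
    obtain ⟨c, hc⟩ := ih
    exact ⟨and φ c, fun X _ ν N w => by simp [Sat, hc]⟩

/-- If all formulas valid in `K` are valid in `Y`, then each finite set of formulas that holds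
throughout a model on `Y` holds throughout a model on a member of `K`: otherwise the negation of
`¬ E ¬ ⋀ Φ` would be valid in `K`. -/
theorem exists_model_of_finite {K : SpaceClass.{u}} {Y : Type u} [TopologicalSpace Y]
    [Nonempty Y] (hY : ∀ φ : HEFormula,
      (∀ (X : Type u) [Nonempty X] [TopologicalSpace X], K X → φ.ValidIn X) → φ.ValidIn Y)
    {Φ : Set HEFormula} (hΦ : Φ.Finite) (ν : ℕ → Set Y) (N : ℕ → Y)
    (h : ∀ φ ∈ Φ, ∀ w, Sat ν N φ w) :
    ∃ (X : Type u) (_ : Nonempty X) (_ : TopologicalSpace X) (ν' : ℕ → Set X) (N' : ℕ → X),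
      K X ∧ ∀ φ ∈ Φ, ∀ w, Sat ν' N' φ w := by
  obtain ⟨c, hc⟩ := exists_conj.{u} hΦ
  by_contra hne
  refine hY (glob (neg c)) ?_ ν N (Classical.arbitrary Y) |>.elim fun w hw =>
    hw ((hc Y ν N w).2 fun φ hφ => h φ hφ w)
  intro X _ _ hX ν' N' _
  by_contra hall
  refine hne ⟨X, inferInstance, inferInstance, ν', N', hX, fun φ hφ w => ?_⟩
  by_contra hw
  exact hall ⟨w, fun hcw => hw ((hc X ν' N' w).1 hcw φ hφ)⟩

/-- Name the members of `S` by propositional letters, and a point of each non-empty member by a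
nominal; the conditions on a partial representation are then expressed by finitely many
formulas. -/
theorem exists_isPartialRepresentation {K : SpaceClass.{u}} {Y : Type u} [TopologicalSpace Y]
    [Nonempty Y] (hY : ∀ φ : HEFormula,
      (∀ (X : Type u) [Nonempty X] [TopologicalSpace X], K X → φ.ValidIn X) → φ.ValidIn Y)
    (S : Finset (Set Y)) :
    ∃ (X : Type u) (_ : Nonempty X) (_ : TopologicalSpace X) (ν : Set Y → Set X),
      K X ∧ IsPartialRepresentation S ν := by
  obtain ⟨e, he⟩ := Set.countable_iff_exists_injOn.1 S.countable_toSet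
  let d : ℕ → Set Y := Function.invFunOn e S
  have hd : ∀ A ∈ S, d (e A) = A := fun A hA => he.leftInvOn_invFunOn hA
  let N (n : ℕ) : Y := Classical.epsilon fun y => y ∈ d n
  have hN : ∀ A ∈ S, A.Nonempty → N (e A) ∈ A := fun A hA hne => by
    have : ∃ y, y ∈ d (e A) := by rwa [hd A hA]
    exact (hd A hA).le (Classical.epsilon_spec this)
  let l (A : Set Y) : HEFormula := prop (e A)
  let T : Set HEFormula := {top} ∪ (fun A => neg (l A)) '' S ∪ (fun A => box (l A)) '' S ∪
    (fun A => nom (e A)) '' S ∪ Set.image2 (fun A B => and (l A) (l B)) S S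
  have hT : T.Finite :=
    ((((Set.finite_singleton _).union (S.finite_toSet.image _)).union
      (S.finite_toSet.image _)).union (S.finite_toSet.image _)).union
        (S.finite_toSet.image2 _ S.finite_toSet)
  let Φ : Set HEFormula := {φ | φ ∈ Set.image2 (fun C χ => biimp (l C) χ) S T ∪
    (fun A => atNom (e A) (l A)) '' S ∧ ∀ w, Sat d N φ w}
  have hΦ : Φ.Finite := ((S.finite_toSet.image2 _ hT).union (S.finite_toSet.image _)).subset
    fun φ hφ => hφ.1
  obtain ⟨X, hX, tX, ν, N', hK, h⟩ := exists_model_of_finite hY hΦ d N fun φ hφ => hφ.2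
  have key : ∀ C ∈ S, ∀ χ ∈ T, (∀ y, Sat d N χ y ↔ y ∈ C) → ν (e C) = {x | Sat ν N' χ x} := by
    intro C hC χ hχ hCχ
    ext x
    refine sat_biimp.1 (h (biimp (l C) χ)
      ⟨Or.inl (Set.mem_image2_of_mem hC hχ), fun w => sat_biimp.2 ?_⟩ x)
    rw [hCχ]
    change w ∈ d (e C) ↔ w ∈ C
    rw [hd C hC]
  refine ⟨X, hX, tX, fun A => ν (e A), hK, ⟨fun hU => ?_, fun A hA B hB hAB => ?_,
    fun A hA hA' => ?_, fun A hA hA' => ?_, fun A hA hne => ?_, fun y hy => ?_⟩⟩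
  · refine (key _ hU top (by simp [T]) (by simp [Sat])).trans ?_
    simp [Sat]
  · refine key _ hAB (and (l A) (l B)) (Or.inr (Set.mem_image2_of_mem hA hB)) fun y => ?_
    simp only [Sat, l, hd A hA, hd B hB, Set.mem_inter_iff]
  · refine key _ hA' (neg (l A))
      (Or.inl (Or.inl (Or.inl (Or.inr (Set.mem_image_of_mem _ hA))))) fun y => ?_
    simp only [Sat, l, hd A hA, Set.mem_compl_iff]
  · refine (key _ hA' (box (l A))
      (Or.inl (Or.inl (Or.inr (Set.mem_image_of_mem _ hA)))) fun y => ?_).trans ?_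
    · rw [sat_box_iff]
      change y ∈ interior (d (e A)) ↔ _
      rw [hd A hA]
    · ext x
      exact sat_box_iff
  · refine ⟨N' (e A), h (atNom (e A) (l A)) ⟨Or.inr (Set.mem_image_of_mem _ hA), fun w => ?_⟩
      (Classical.arbitrary X)⟩
    simp only [Sat, l, hd A hA]
    exact hN A hA hne
  · have h₁ : N (e {y}) = y := hN {y} hy (Set.singleton_nonempty y)
    have h₂ := key _ hy (nom (e {y})) (Or.inl (Or.inr (Set.mem_image_of_mem _ hy))) fun z => by
      simp only [Sat, h₁, Set.mem_singleton_iff]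
    intro x hx x' hx'
    simp only [h₂, Sat, Set.mem_ofPred_eq] at hx hx'
    rw [hx, hx']

end HEFormula

/-! ### Definability in `H(E)` -/

theorem closedUnderUMorphicImages_of_heDefinable {K : SpaceClass.{u}} (hK : HEDefinable K) :
    ClosedUnderUMorphicImages K := by
  obtain ⟨Γ, hΓ⟩ := hK
  intro X Y _ _ _ _ hX h
  exact (hΓ Y).2 fun φ hφ => ((hΓ X).1 hX φ hφ).of_isUMorphicImage h

theorem heDefinable_of_closedUnderUMorphicImages {K : SpaceClass.{u}} (hK : LtDefinable K)
    (hcl : ClosedUnderUMorphicImages K) : HEDefinable K := by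
  obtain ⟨Γ, hΓ, hKΓ⟩ := hK
  refine ⟨{φ | ∀ (X : Type u) [Nonempty X] [TopologicalSpace X], K X → φ.ValidIn X},
    fun Y _ _ => ⟨fun hY φ hφ => hφ Y hY, fun hY => ?_⟩⟩
  choose X hne top ν hX hν using HEFormula.exists_isPartialRepresentation (K := K) hY
  obtain ⟨D, hD⟩ := isUMorphicImage_limitUltraproduct hν
  refine hcl (LimitUltraproduct D X) Y ((hKΓ _).2 fun α hα => ?_) hD
  exact LimitUltraproduct.spaceModels (hΓ α hα).1 (hΓ α hα).2 fun S => (hKΓ (X S)).1 (hX S) α hα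

theorem theorem5p6 (K : SpaceClass.{u}) (hK : LtDefinable K) :
    HEDefinable K ↔ ClosedUnderUMorphicImages K :=
  ⟨closedUnderUMorphicImages_of_heDefinable, heDefinable_of_closedUnderUMorphicImages hK⟩
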